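/- Let $M$ be a matroid of rank $r$ on a finite set $E$ with a fixed linear order $<$, and let $M^\perp$ be the dual matroid. For $S\subseteq E$ let $\operatorname{EA}(S)$ be the set of $e\in E\setminus S$ that are the maximum of some circuit of $M$ contained in $S\cup\{e\}$, and let $\operatorname{IA}(S)$ be the set of $i\in S$ that are the maximum of some circuit of $M^\perp$ contained in $(E\setminus S)\cup\{i\}$. Every independent set $I$ can be written as $I=B_I\setminus Y$ for a unique basis $B_I$ with $Y\subseteq\operatorname{IA}(B_I)$; call $I$ and $J$ internally related if $B_I=B_J$. On independent sets let $I\le_{ext/int}J$ mean: either $I,J$ are internally related and $I\subseteq J$, or they are not internally related and $(I\setminus\operatorname{IA}(I))\cup\operatorname{EA}(I)\subseteq (J\setminus\operatorname{IA}(J))\cup\operatorname{EA}(J)$. A broken circuit is a circuit with its maximum element deleted. Let $\mathrm{NBC}(M)$ be the simplicial complex of all subsets of $E$ (the nbc sets, which are independent) that contain no broken circuit. The augmented nbc complex $\Delta^{\mathrm{nbc}}_M$ is the simplicial complex on the vertices $\{y_e,z_e : e\in E\}$ whose facets are $G(I)=\{y_e : e\in B_I\setminus I\}\cup\{z_e: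 e\in I\}$ for all nbc sets $I$. The $f$-vector $(f_0,\dots,f_d)$ of a simplicial complex of dimension $d-1$ counts its faces by cardinality (the empty face included). Its $h$-polynomial is $\sum_i f_i(q-1)^{d-i}=\sum_i h_i q^{d-i}$, and its $h$-vector is $(h_0,\dots,h_d)$. For the void complex, which has no face (as $\mathrm{NBC}(M)$ and $\Delta^{\mathrm{nbc}}_M$ do when $M$ has a loop), put $d=0$. Let $T_M(x,y)=\sum_{S\subseteq E}(x-1)^{r-r(S)}(y-1)^{|S|-r(S)}$ be the Tutte polynomial, where $r(S)$ is the rank of $S$. 1. Let $\prec$ be any linear extension of the restriction of $\le_{ext/int}$ to the nbc sets. Then $I\mapsto G(I)$, ordered by $\prec$, is a shelling order of the facets of the pure complex $\Delta^{\mathrm{nbc}}_M$, that is, for all $I\prec K$ there are $J\prec K$ and $e\in G(K)$ with $G(I)\cap G(K)\subseteq G(J)\cap G(K)=G(K)\setminus\{e\}$. For every nbc set $I$ the restriction set of $G(I)$ in this shelling is $z_I=\{z_e:e\in I\}$; that is, for every $A\subseteq G(I)$ we have $z_I\subseteq A$ if and only if $A\not\subseteq G(J)$ for every $J\prec I$.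 2. The $h$-polynomial of $\Delta^{\mathrm{nbc}}_M$ is $T_M(1+q,0)$, and the $h$-vector of $\Delta^{\mathrm{nbc}}_M$ is equal to the $f$-vector of $\mathrm{NBC}(M)$. -/

import Mathlib

open Polynomial

namespace AugNBC

/-! ## Simplicial complexes, `f`- and `h`-vectors, shellings -/

section Complexes

/-- A (finite, when used) abstract simplicial complex on the vertex type `V`: a family of finite
sets closed under taking subsets. The empty face is counted as a face, as usual for `f`- and
`h`-vectors; the void complex, without any face, is allowed. -/
structure Complex (V : Type*) where
  faces : Set (Finset V)
  down_closed : IsLowerSet faces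

variable {V : Type*}

/-- The facets of a complex: its inclusion-maximal faces. -/
def Complex.facets (Δ : Complex V) : Set (Finset V) :=
  {F | Maximal (fun A => A ∈ Δ.faces) F}

/-- The largest cardinality of a face, that is, one more than the dimension
(`0` for the void complex). -/
noncomputable def Complex.size (Δ : Complex V) : ℕ :=
  sSup (Finset.card '' Δ.faces)

/-- All facets have the same cardinality. -/
def Complex.IsPure (Δ : Complex V) : Prop :=
  ∀ F ∈ Δ.facets, ∀ F' ∈ Δ.facets, F.card = F'.card

/-- `fNum Δ i` is the number of faces with `i` elements (of dimension `i - 1`). -/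
noncomputable def Complex.fNum (Δ : Complex V) (i : ℕ) : ℕ :=
  {A | A ∈ Δ.faces ∧ A.card = i}.ncard

/-- The `h`-polynomial `∑_{i=0}^{d} f_i (q - 1)^{d - i}`, where `d = dim Δ + 1`. -/
noncomputable def Complex.hPoly (Δ : Complex V) : ℤ[X] :=
  ∑ i ∈ Finset.range (Δ.size + 1), C (Δ.fNum i : ℤ) * (X - 1) ^ (Δ.size - i)

/-- The `f`-vector `(f_0, …, f_d)`, where `d = dim Δ + 1`. -/
noncomputable def Complex.fVector (Δ : Complex V) : List ℤ :=
  (List.range (Δ.size + 1)).map fun i => (Δ.fNum i : ℤ)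

/-- The `h`-vector `(h_0, …, h_d)`, where `d = dim Δ + 1` and `∑ h_i q^{d - i}` is the
`h`-polynomial. -/
noncomputable def Complex.hVector (Δ : Complex V) : List ℤ :=
  (List.range (Δ.size + 1)).map fun i => Δ.hPoly.coeff (Δ.size - i)

/-- The family `F`, with its index set strictly totally ordered by `lt`, lists every facet of `Δ`
exactly once, and this is a shelling order of the pure complex `Δ`. -/
structure IsShelling [DecidableEq V] {ι : Type*} (Δ : Complex V) (lt : ι → ι → Prop)
    (F : ι → Finset V) : Prop where
  strictTotal : IsStrictTotalOrder ι lt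
  pure : Δ.IsPure
  injective : Function.Injective F
  range_eq : Set.range F = Δ.facets
  shelling : ∀ i k, lt i k → ∃ j, lt j k ∧ ∃ e ∈ F k,
    F i ∩ F k ⊆ F j ∩ F k ∧ F j ∩ F k = (F k).erase e

/-- `R` is the restriction set of `F k` in the facet order `lt`: the faces of `F k` that lie in no
earlier facet are exactly those containing `R`. (There is at most one such `R`.) -/
def IsRestrictionSet {ι : Type*} (lt : ι → ι → Prop) (F : ι → Finset V) (k : ι)
    (R : Finset V) : Prop :=
  R ⊆ F k ∧ ∀ A ⊆ F k, (R ⊆ A ↔ ∀ i, lt i k → ¬ A ⊆ F i)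

end Complexes

/-! ## Activities -/

section Matroids

variable {α : Type*} [LinearOrder α]

/-- The elements externally active with respect to `S`: those `e ∉ S` that are the maximum of some
circuit contained in `S ∪ e`. -/
def extActive (M : Matroid α) (S : Set α) : Set α :=
  {e | e ∈ M.E \ S ∧ ∃ γ, M.IsCircuit γ ∧ γ ⊆ insert e S ∧ IsGreatest γ e}

/-- The elements internally active with respect to `S`: those `i ∈ S` that are externally active
with respect to `E \ S` in the dual matroid. -/
def intActive (M : Matroid α) (S : Set α) : Set α :=
  {i | i ∈ S ∧ i ∈ extActive M✶ (M.E \ S)}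

/-- `I` is related to the basis `B`: `I = B \ Y` for some `Y ⊆ IA(B)`. -/
def IsRelatedBasis (M : Matroid α) (I B : Finset α) : Prop :=
  M.IsBase (B : Set α) ∧ ∃ Y : Finset α, (Y : Set α) ⊆ intActive M (B : Set α) ∧ I = B \ Y

/-- Every independent set is related to exactly one basis. -/
theorem existsUnique_isRelatedBasis (M : Matroid α) [M.Finite] {I : Finset α}
    (hI : M.Indep (I : Set α)) : ∃! B : Finset α, IsRelatedBasis M I B := by
  have key : ∀ B B' : Finset α, IsRelatedBasis M I B → IsRelatedBasis M I B' → ∀ x ∈ B, x ∉ B' →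
      ∃ y ∈ B', y ∉ B ∧ y < x := by
    rintro B B' ⟨hB, Y, hY, rfl⟩ ⟨hB', Y', -, hI'⟩ x hx hx'
    have hxY : x ∈ Y := by
      by_contra hxY
      have : x ∈ B \ Y := by simp [hx, hxY]
      rw [hI'] at this
      exact hx' (Finset.mem_sdiff.1 this).1
    obtain ⟨-, -, γ, hγ, hsub, -, hmax⟩ := hY (Finset.mem_coe.2 hxY)
    obtain ⟨y, hyγ, hyB'⟩ := (Matroid.isCocircuit_iff_minimal.1 hγ).1 _ hB'
    have hyx : y ≠ x := by
      rintro rfl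
      exact hx' hyB'
    refine ⟨y, hyB', ?_, lt_of_le_of_ne (hmax hyγ) hyx⟩
    have := (hsub hyγ).resolve_left hyx
    exact this.2
  have uniq : ∀ B B' : Finset α, IsRelatedBasis M I B → IsRelatedBasis M I B' → B = B' := by
    intro B B' h h'
    by_contra hne
    have hs : (symmDiff B B').Nonempty := by
      rw [Finset.nonempty_iff_ne_empty]
      exact fun h0 => hne (symmDiff_eq_bot.1 h0)
    obtain ⟨x, hx, hmin⟩ := Finset.exists_min_image _ id hs
    rcases Finset.mem_symmDiff.1 hx with ⟨h1, h2⟩ | ⟨h1, h2⟩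
    · obtain ⟨y, hy, hy', hlt⟩ := key B B' h h' x h1 h2
      exact absurd (hmin y (Finset.mem_symmDiff.2 (Or.inr ⟨hy, hy'⟩))) (not_le.2 hlt)
    · obtain ⟨y, hy, hy', hlt⟩ := key B' B h' h x h1 h2
      exact absurd (hmin y (Finset.mem_symmDiff.2 (Or.inl ⟨hy, hy'⟩))) (not_le.2 hlt)
  -- the colexicographically largest basis containing `I` is related to `I`
  have hfin : {B : Finset α | M.IsBase (B : Set α) ∧ I ⊆ B}.Finite := by
    refine (M.ground_finite.toFinset.powerset.finite_toSet).subset fun B hB => ?_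
    simp only [Finset.mem_coe, Finset.mem_powerset]
    intro x hx
    simpa using hB.1.subset_ground hx
  have hne : {B : Finset α | M.IsBase (B : Set α) ∧ I ⊆ B}.Nonempty := by
    obtain ⟨B, hB, hIB⟩ := hI.exists_isBase_superset
    have hBf : B.Finite := M.ground_finite.subset hB.subset_ground
    refine ⟨hBf.toFinset, by simpa using hB, fun x hx => ?_⟩
    simpa using hIB hx
  obtain ⟨B, ⟨hB, hIB⟩, hmax⟩ := Set.exists_max_image _ (fun B => toColex B) hfin hne
  have main : ∀ y ∈ (↑(B \ I) : Set α), y ∈ intActive M (B : Set α) := by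
    intro y hy
    obtain ⟨hyB, hyI⟩ := Finset.mem_sdiff.1 (Finset.mem_coe.1 hy)
    refine ⟨hyB, ⟨hB.subset_ground hyB, fun h => h.2 hyB⟩, M.fundCocircuit y B,
      Matroid.fundCocircuit_isCocircuit hyB hB, M.fundCocircuit_subset_insert_compl y B,
      M.mem_fundCocircuit y B, fun z hz => ?_⟩
    by_contra hlt
    rw [not_le] at hlt
    obtain ⟨hzE, hzB⟩ :=
      ((M.fundCocircuit_subset_insert_compl y B) hz).resolve_left hlt.ne'
    rw [hB.mem_fundCocircuit_iff_mem_fundCircuit,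
      hB.indep.mem_fundCircuit_iff (by rwa [hB.closure_eq]) hzB] at hz
    have hbase := hB.exchange_isBase_of_indep' hyB hzB hz
    have hle := hmax ((insert z B).erase y) ⟨by simpa using hbase, fun a ha => by
      have : a ≠ y := by
        rintro rfl
        exact hyI ha
      simp [this, hIB ha]⟩
    refine absurd hle (not_le.2 ?_)
    rw [Finset.Colex.toColex_lt_toColex]
    refine ⟨fun h => ?_, fun a ha ha' => ?_⟩
    · rw [h] at hyB
      simp at hyB
    · have hay : a = y := by
        by_contra hay
        exact ha' (by simp [hay, ha])
      subst hay
      exact ⟨z, by simp [hlt.ne'], hzB, hlt.le⟩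
  have hrel : IsRelatedBasis M I B :=
    ⟨hB, B \ I, main, by simp [Finset.inter_eq_right.2 hIB]⟩
  exact ⟨B, hrel, fun B' h' => uniq _ _ h' hrel⟩

/-- The unique basis related to the independent set `I` (arbitrary if `I` is not independent). -/
noncomputable def relatedBasis (M : Matroid α) (I : Finset α) : Finset α :=
  Classical.epsilon fun B => IsRelatedBasis M I B

theorem isRelatedBasis_relatedBasis (M : Matroid α) [M.Finite] {I : Finset α}
    (hI : M.Indep (I : Set α)) : IsRelatedBasis M I (relatedBasis M I) :=
  Classical.epsilon_spec (existsUnique_isRelatedBasis M hI).exists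

/-- `I` and `J` are internally related: they are related to a common basis. -/
def InternallyRelated (M : Matroid α) (I J : Finset α) : Prop :=
  ∃ B : Finset α, IsRelatedBasis M I B ∧ IsRelatedBasis M J B

/-- The external/internal order on independent sets. -/
def ExtIntLE (M : Matroid α) (I J : Finset α) : Prop :=
  (¬ InternallyRelated M I J ∧
    ((I : Set α) \ intActive M (I : Set α)) ∪ extActive M (I : Set α) ⊆
      ((J : Set α) \ intActive M (J : Set α)) ∪ extActive M (J : Set α)) ∨
  (InternallyRelated M I J ∧ I ⊆ J)

/-! ## The no broken circuit complex and its augmentation -/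

/-- A broken circuit: a circuit with its maximum element deleted. -/
def IsBrokenCircuit (M : Matroid α) (β : Set α) : Prop :=
  ∃ γ e, M.IsCircuit γ ∧ IsGreatest γ e ∧ β = γ \ {e}

/-- The no broken circuit complex: all subsets of the ground set that contain no broken circuit. -/
def nbc (M : Matroid α) : Complex α where
  faces := {S | (S : Set α) ⊆ M.E ∧ ∀ β, IsBrokenCircuit M β → ¬ β ⊆ (S : Set α)}
  down_closed := fun _ _ hTS hS =>
    ⟨(Finset.coe_subset.2 hTS).trans hS.1,
      fun β hβ h => hS.2 β hβ (h.trans (Finset.coe_subset.2 hTS))⟩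

/-- The nbc sets of `M`. -/
abbrev NBCSet (M : Matroid α) : Type _ := {I : Finset α // I ∈ (nbc M).faces}

/-- The set `y_S z_T` of vertices. In the vertex type `α ⊕ α`, `Sum.inl e` is `y_e` and
`Sum.inr e` is `z_e`. -/
def yz (S T : Finset α) : Finset (α ⊕ α) := S.disjSum T

/-- `G(I) = y_{B_I \ I} z_I`, where `B_I` is the basis related to `I`. -/
noncomputable def facetG (M : Matroid α) (I : NBCSet M) : Finset (α ⊕ α) :=
  yz (relatedBasis M I.1 \ I.1) I.1

/-- The augmented nbc complex, generated by the sets `G(I)` for all nbc sets `I`. -/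
noncomputable def augNBC (M : Matroid α) : Complex (α ⊕ α) where
  faces := {A | ∃ I : NBCSet M, A ⊆ facetG M I}
  down_closed := fun _ _ hBA ⟨I, hI⟩ => ⟨I, hBA.trans hI⟩

/-- `lt` is (the strict part of) a linear extension of the external/internal order restricted to
the nbc sets. -/
structure IsLinearExtension (M : Matroid α) (lt : NBCSet M → NBCSet M → Prop) : Prop where
  strictTotal : IsStrictTotalOrder (NBCSet M) lt
  extends_le : ∀ I J : NBCSet M, ExtIntLE M I.1 J.1 → I ≠ J → lt I J

end Matroids

/-! ## The Tutte polynomial -/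

/-- The Tutte polynomial
`T_M(x, y) = ∑_{S ⊆ E} (x - 1)^{r(E) - r(S)} (y - 1)^{|S| - r(S)}`,
with `x` and `y` the variables `0` and `1`. -/
noncomputable def tutte {α : Type*} (M : Matroid α) [M.Finite] : MvPolynomial (Fin 2) ℤ :=
  ∑ S ∈ M.ground_finite.toFinset.powerset,
    (MvPolynomial.X 0 - 1) ^ ((M.eRk M.E).toNat - (M.eRk (S : Set α)).toNat) *
      (MvPolynomial.X 1 - 1) ^ (S.card - (M.eRk (S : Set α)).toNat)

end AugNBC

namespace AugNBC

/-! ### Activities of nbc sets and their related bases. -/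

section Activities

variable {α : Type*} [LinearOrder α] {M : Matroid α}

/-! An nbc set has no externally active elements, and internal activity passes to subsets containing
the element. So inclusion of nbc sets implies `ExtIntLE`, and every linear extension refines
inclusion; the shelling needs nothing else from the order. The matroid input is
`IsRelatedBasis.sdiff_subset_sdiff`: by it, deleting z_k from G(K) leaves a face of the earlier
facet G(K \ {k}). Conversely, a face containing z_K lies only in facets G(I) with K ⊆ I, none of
them earlier.

The h-polynomial is computed without the shelling. Faces are y_S z_T with T nbc and S ⊆ B_T \ T, and
for fixed T the binomial theorem sums them to q^(r - |T|). The total over T is T_M(1 + q, 0) by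
Whitney's theorem, proved by a sign-reversing involution on the sets that are not nbc. Its
coefficients are the f-vector of NBC(M), since B_∅ is nbc and so both complexes have size r. -/

theorem indep_of_mem_nbc [M.Finite] {I : Finset α} (hI : I ∈ (nbc M).faces) :
    M.Indep (I : Set α) := by
  by_contra hdep
  obtain ⟨γ, hγI, hγ⟩ := ((Matroid.not_indep_iff hI.1).1 hdep).exists_isCircuit_subset
  obtain ⟨e, heγ, he⟩ := Set.exists_max_image γ id (M.ground_finite.subset hγ.subset_ground)
    hγ.nonempty
  exact hI.2 _ ⟨γ, e, hγ, ⟨heγ, he⟩, rfl⟩ (Set.sdiff_subset.trans hγI)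

theorem extActive_eq_empty_of_mem_nbc {I : Finset α} (hI : I ∈ (nbc M).faces) :
    extActive M (I : Set α) = ∅ := by
  rw [Set.eq_empty_iff_forall_notMem]
  rintro e ⟨-, γ, hγ, hsub, hmax⟩
  exact hI.2 _ ⟨γ, e, hγ, hmax, rfl⟩ (Set.sdiff_singleton_subset_iff.2 hsub)

/-- The complement grows as the set shrinks, so the same cocircuit is a witness. -/
theorem mem_intActive_of_subset {S T : Set α} (hST : S ⊆ T) {i : α} (hiS : i ∈ S)
    (hi : i ∈ intActive M T) : i ∈ intActive M S := by
  obtain ⟨-, ⟨hiE, -⟩, γ, hγ, hsub, hmax⟩ := hi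
  exact ⟨hiS, ⟨hiE, fun h => h.2 hiS⟩, γ, hγ,
    hsub.trans (Set.insert_subset_insert (Set.sdiff_subset_sdiff_right hST)), hmax⟩

theorem extIntLE_of_subset {I J : Finset α} (hI : I ∈ (nbc M).faces) (hJ : J ∈ (nbc M).faces)
    (hIJ : I ⊆ J) : ExtIntLE M I J := by
  by_cases h : InternallyRelated M I J
  · exact Or.inr ⟨h, hIJ⟩
  · refine Or.inl ⟨h, ?_⟩
    rw [extActive_eq_empty_of_mem_nbc hI, extActive_eq_empty_of_mem_nbc hJ, Set.union_empty,
      Set.union_empty]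
    rintro i ⟨hiI, hi⟩
    have hIJ' := Finset.coe_subset.2 hIJ
    exact ⟨hIJ' hiI, fun h => hi (mem_intActive_of_subset hIJ' hiI h)⟩

theorem IsRelatedBasis.subset {I B : Finset α} (h : IsRelatedBasis M I B) : I ⊆ B := by
  obtain ⟨-, Y, -, rfl⟩ := h
  exact Finset.sdiff_subset

theorem IsRelatedBasis.mem_intActive {I B : Finset α} (h : IsRelatedBasis M I B) {y : α}
    (hyB : y ∈ B) (hyI : y ∉ I) : y ∈ intActive M (B : Set α) := by
  obtain ⟨-, Y, hY, rfl⟩ := h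
  exact hY (by simpa [hyB] using hyI)

/-- Passing to a smaller independent set enlarges the part of the related basis outside it. -/
theorem IsRelatedBasis.sdiff_subset_sdiff {I J B B' : Finset α} (hIJ : I ⊆ J)
    (hI : IsRelatedBasis M I B) (hJ : IsRelatedBasis M J B') : B' \ J ⊆ B \ I := by
  intro y hy
  obtain ⟨hyB', hyJ⟩ := Finset.mem_sdiff.1 hy
  refine Finset.mem_sdiff.2 ⟨?_, fun h => hyJ (hIJ h)⟩
  by_contra hyB
  obtain ⟨-, -, γ, hγ, hγsub, hγmax⟩ := hJ.mem_intActive hyB' hyJ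
  have hyE : y ∈ M.E := hJ.1.subset_ground (Finset.mem_coe.2 hyB')
  -- A circuit and a cocircuit never meet in exactly one element. Hence C, the fundamental circuit
  -- of y, meets γ in some z < y, and z lies in B \ I. The cocircuit γ' with maximum z meets C
  -- again, necessarily at y, the only element of C outside B; so y ≤ z.
  have hC := hI.1.fundCircuit_isCircuit hyE (by simpa using hyB)
  obtain ⟨z, ⟨hzC, hzγ⟩, hzy⟩ : ∃ z ∈ M.fundCircuit y B ∩ γ, z ≠ y := by
    by_contra! h
    exact hC.inter_isCocircuit_ne_singleton hγ
      (Set.eq_singleton_iff_unique_mem.2 ⟨⟨M.mem_fundCircuit y B, hγmax.1⟩, h⟩)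
  have hzB : z ∈ B := (M.fundCircuit_subset_insert y B hzC).resolve_left hzy
  have hzI : z ∉ I := fun h =>
    ((hγsub hzγ).resolve_left hzy).2 (Finset.mem_coe.2 (hJ.subset (hIJ h)))
  obtain ⟨-, -, γ', hγ', hγsub', hγmax'⟩ := hI.mem_intActive hzB hzI
  obtain ⟨w, ⟨hwC, hwγ'⟩, hwz⟩ : ∃ w ∈ M.fundCircuit y B ∩ γ', w ≠ z := by
    by_contra! h
    exact hC.inter_isCocircuit_ne_singleton hγ'
      (Set.eq_singleton_iff_unique_mem.2 ⟨⟨hzC, hγmax'.1⟩, h⟩)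
  have hwy : w = y := (M.fundCircuit_subset_insert y B hwC).resolve_right
    ((hγsub' hwγ').resolve_left hwz).2
  exact hzy (le_antisymm (hγmax.2 hzγ) (hwy ▸ hγmax'.2 hwγ'))

/-- If the empty set is an nbc set, then so is the basis related to it. -/
theorem relatedBasis_empty_mem_nbc {B : Finset α} (h0 : ∅ ∈ (nbc M).faces)
    (hB : IsRelatedBasis M ∅ B) : B ∈ (nbc M).faces := by
  refine ⟨hB.1.subset_ground, ?_⟩
  rintro _ ⟨γ, e, hγ, hmax, rfl⟩ hsub
  have hne : (γ \ {e}).Nonempty := by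
    rw [Set.nonempty_iff_ne_empty]
    intro h
    exact h0.2 _ ⟨γ, e, hγ, hmax, rfl⟩ (by simp [h])
  obtain ⟨y, hyγ, hye⟩ := hne
  obtain ⟨-, -, γ', hγ', hsub', hmax'⟩ :=
    hB.mem_intActive (Finset.mem_coe.1 (hsub ⟨hyγ, hye⟩)) (Finset.notMem_empty y)
  -- Orthogonality again: a second common element is outside B, so it is e. Then e ≤ y, although e
  -- is the maximum of γ.
  obtain ⟨z, ⟨hzγ, hzγ'⟩, hzy⟩ : ∃ z ∈ γ ∩ γ', z ≠ y := by
    by_contra! h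
    exact hγ.inter_isCocircuit_ne_singleton hγ'
      (Set.eq_singleton_iff_unique_mem.2 ⟨⟨hyγ, hmax'.1⟩, h⟩)
  have hze : z = e := by
    by_contra hze
    exact ((hsub' hzγ').resolve_left hzy).2 (hsub ⟨hzγ, hze⟩)
  exact hye (le_antisymm (hmax.2 hyγ) (hze ▸ hmax'.2 hzγ'))

end Activities

/-! ### Facets, shelling order and restriction sets. -/

section Shelling

variable {α : Type*} [LinearOrder α] {M : Matroid α}

theorem toRight_facetG (I : NBCSet M) : (facetG M I).toRight = I.1 :=
  Finset.toRight_disjSum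

theorem facetG_injective : Function.Injective (facetG M) := fun I J h =>
  Subtype.ext (by rw [← toRight_facetG I, h, toRight_facetG])

theorem IsLinearExtension.lt_of_ssubset {lt : NBCSet M → NBCSet M → Prop}
    (h : IsLinearExtension M lt) {I J : NBCSet M} (hIJ : I.1 ⊂ J.1) : lt I J :=
  h.extends_le I J (extIntLE_of_subset I.2 J.2 hIJ.1) fun e => hIJ.ne (congrArg _ e)

theorem IsLinearExtension.not_subset_of_lt {lt : NBCSet M → NBCSet M → Prop}
    (h : IsLinearExtension M lt) {I K : NBCSet M} (hlt : lt I K) : ¬ K.1 ⊆ I.1 := by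
  have := h.strictTotal
  intro hKI
  rcases hKI.eq_or_ssubset with he | hs
  · obtain rfl : K = I := Subtype.ext he
    exact irrefl_of lt K hlt
  · exact irrefl_of lt K (trans_of lt (h.lt_of_ssubset hs) hlt)

variable [M.Finite]

theorem isRelatedBasis_of_nbcSet (I : NBCSet M) : IsRelatedBasis M I.1 (relatedBasis M I.1) :=
  isRelatedBasis_relatedBasis M (indep_of_mem_nbc I.2)

theorem card_facetG (I : NBCSet M) : (facetG M I).card = (M.eRk M.E).toNat := by
  have h := isRelatedBasis_of_nbcSet I
  rw [facetG, yz, Finset.card_disjSum, Finset.card_sdiff_add_card_eq_card h.subset,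
    Matroid.eRk_eq_eRank subset_rfl, ← h.1.encard_eq_eRank, Set.encard_coe_eq_coe_finsetCard,
    ENat.toNat_natCast]

theorem mem_facets_augNBC {F : Finset (α ⊕ α)} :
    F ∈ (augNBC M).facets ↔ F ∈ Set.range (facetG M) := by
  constructor
  · rintro ⟨⟨I, hI⟩, hmax⟩
    exact ⟨I, (hmax ⟨I, subset_rfl⟩ hI).antisymm hI⟩
  · rintro ⟨I, rfl⟩
    refine ⟨⟨I, subset_rfl⟩, ?_⟩
    rintro A ⟨J, hJ⟩ hIA
    -- All generators have r elements, so none properly contains another.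
    have := Finset.eq_of_subset_of_card_le (hIA.trans hJ) (by rw [card_facetG, card_facetG])
    exact this ▸ hJ

/-- A face `y_S z_T` of `G(J)` is contained in `G(I)` whenever `T ⊆ I ⊆ J`. -/
theorem subset_facetG_of_toRight {A : Finset (α ⊕ α)} {I J : NBCSet M} (hA : A ⊆ facetG M J)
    (hI : A.toRight ⊆ I.1) (hIJ : I.1 ⊆ J.1) : A ⊆ facetG M I := by
  refine Finset.subset_disjSum.2 ⟨?_, hI⟩
  refine (Finset.subset_disjSum.1 hA).1.trans ?_
  exact (isRelatedBasis_of_nbcSet I).sdiff_subset_sdiff hIJ (isRelatedBasis_of_nbcSet J)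

/-- The nbc set obtained by deleting one element. -/
def NBCSet.erase (K : NBCSet M) (k : α) : NBCSet M :=
  ⟨K.1.erase k, (nbc M).down_closed (Finset.erase_subset k K.1) K.2⟩

/-- The ridge opposite z_k lies in G(K \ {k}), which precedes G(K) when k ∈ K. This gives both the
shelling condition and the restriction sets. -/
theorem erase_subset_facetG (K : NBCSet M) (k : α) :
    (facetG M K).erase (Sum.inr k) ⊆ facetG M (K.erase k) := by
  refine subset_facetG_of_toRight (Finset.erase_subset _ _) ?_ (Finset.erase_subset k K.1)
  intro x hx
  simpa [facetG, yz, NBCSet.erase] using hx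

theorem IsLinearExtension.isShelling {lt : NBCSet M → NBCSet M → Prop}
    (h : IsLinearExtension M lt) : IsShelling (augNBC M) lt (facetG M) where
  strictTotal := h.strictTotal
  pure := by
    intro F hF F' hF'
    obtain ⟨I, rfl⟩ := mem_facets_augNBC.1 hF
    obtain ⟨J, rfl⟩ := mem_facets_augNBC.1 hF'
    rw [card_facetG, card_facetG]
  injective := facetG_injective
  range_eq := Set.ext fun _ => mem_facets_augNBC.symm
  shelling := by
    intro I K hlt
    obtain ⟨k, hkK, hkI⟩ := Finset.not_subset.1 (h.not_subset_of_lt hlt)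
    have hK : facetG M (K.erase k) ∩ facetG M K = (facetG M K).erase (Sum.inr k) := by
      refine subset_antisymm ?_
        (Finset.subset_inter (erase_subset_facetG K k) (Finset.erase_subset _ _))
      rw [Finset.subset_erase]
      exact ⟨Finset.inter_subset_right, by simp [facetG, yz, NBCSet.erase]⟩
    refine ⟨K.erase k, h.lt_of_ssubset (Finset.erase_ssubset hkK), Sum.inr k,
      Finset.inr_mem_disjSum.2 hkK, ?_, hK⟩
    rw [hK, Finset.subset_erase]
    exact ⟨Finset.inter_subset_right, by simp [facetG, yz, hkI]⟩

theorem IsLinearExtension.isRestrictionSet {lt : NBCSet M → NBCSet M → Prop}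
    (h : IsLinearExtension M lt) (K : NBCSet M) :
    IsRestrictionSet lt (facetG M) K (yz ∅ K.1) := by
  refine ⟨Finset.disjSum_mono (Finset.empty_subset _) subset_rfl, fun A hA => ⟨?_, ?_⟩⟩
  · intro hKA I hlt hAI
    refine h.not_subset_of_lt hlt ?_
    have := Finset.toRight_subset_toRight (hKA.trans hAI)
    rwa [toRight_facetG, yz, Finset.toRight_disjSum] at this
  · intro hA'
    refine Finset.disjSum_subset.2 ⟨Finset.empty_subset _, fun k hk => ?_⟩
    by_contra hkA
    rw [Finset.mem_toRight] at hkA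
    exact hA' _ (h.lt_of_ssubset (Finset.erase_ssubset hk))
      ((Finset.subset_erase.2 ⟨hA, hkA⟩).trans (erase_subset_facetG K k))

end Shelling

theorem toNat_eRk_le_card {α : Type*} (M : Matroid α) (S : Finset α) :
    (M.eRk (S : Set α)).toNat ≤ S.card := by
  have h := M.eRk_le_encard (S : Set α)
  rw [Set.encard_coe_eq_coe_finsetCard] at h
  exact ENat.toNat_le_of_le_natCast h

theorem subset_ground_iff {α : Type*} {M : Matroid α} [M.Finite] {S : Finset α} :
    S ⊆ M.ground_finite.toFinset ↔ (S : Set α) ⊆ M.E := by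
  rw [← Finset.coe_subset, Set.Finite.coe_toFinset]

/-! ### Whitney's broken circuit theorem. -/

section Whitney

variable {α : Type*} [LinearOrder α] {M : Matroid α}

/-- The elements that are the maximum of some circuit whose other elements all lie in `S`. -/
def closing (M : Matroid α) (S : Set α) : Set α :=
  {e | e ∈ M.closure (S ∩ Set.Iio e)}

theorem mem_nbc_iff_closing_eq_empty {S : Finset α} (hS : (S : Set α) ⊆ M.E) :
    S ∈ (nbc M).faces ↔ closing M (S : Set α) = ∅ := by
  rw [Set.eq_empty_iff_forall_notMem]
  constructor
  · intro h e he
    -- The side condition is e ∉ S ∩ Iio e, which holds even if e ∈ S.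
    obtain ⟨γ, hsub, hγ, heγ⟩ := (Matroid.mem_closure_iff_exists_isCircuit (by simp)).1 he
    refine h.2 _ ⟨γ, e, hγ, ⟨heγ, fun x hx => ?_⟩, rfl⟩
      (Set.sdiff_singleton_subset_iff.2
        (hsub.trans (Set.insert_subset_insert Set.inter_subset_left)))
    rcases hsub hx with rfl | hx
    · exact le_rfl
    · exact hx.2.le
  · refine fun h => ⟨hS, ?_⟩
    rintro _ ⟨γ, e, hγ, hmax, rfl⟩ hsub
    refine h e (M.closure_subset_closure ?_ (hγ.mem_closure_sdiff_singleton_of_mem hmax.1))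
    exact fun x hx => ⟨hsub hx, lt_of_le_of_ne (hmax.2 hx.1) hx.2⟩

theorem closure_insert_inter_Iio {S : Set α} {e f : α} (he : e ∈ closing M S) (hef : e < f) :
    M.closure (insert e S ∩ Set.Iio f) = M.closure (S ∩ Set.Iio f) := by
  rw [Set.insert_inter_of_mem (Set.mem_Iio.2 hef)]
  exact Matroid.closure_insert_eq_of_mem_closure (M.closure_subset_closure
    (Set.inter_subset_inter_right _ (Set.Iio_subset_Iio hef.le)) he)

theorem insert_inter_Iio_self (S : Set α) (e : α) :
    insert e S ∩ Set.Iio e = S ∩ Set.Iio e :=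
  Set.insert_inter_of_notMem (by simp)

/-- Membership of e depends only on elements below e. If e is closing, it is already spanned by
smaller elements of S, so adding it changes no closure relevant to larger f. This makes toggling the
greatest element an involution. -/
theorem isGreatest_closing_insert {S : Set α} {e : α} :
    IsGreatest (closing M (insert e S)) e ↔ IsGreatest (closing M S) e := by
  have hself : e ∈ closing M (insert e S) ↔ e ∈ closing M S := by
    simp only [closing, Set.mem_ofPred_eq, insert_inter_Iio_self]
  have hgt (he : e ∈ closing M S) (f : α) (hf : e < f) :
      f ∈ closing M (insert e S) ↔ f ∈ closing M S := by
    simp only [closing, Set.mem_ofPred_eq, closure_insert_inter_Iio he hf]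
  constructor
  · rintro ⟨he, hmax⟩
    refine ⟨hself.1 he, fun f hf => le_of_not_gt fun hlt => ?_⟩
    exact (hmax ((hgt (hself.1 he) f hlt).2 hf)).not_gt hlt
  · rintro ⟨he, hmax⟩
    refine ⟨hself.2 he, fun f hf => le_of_not_gt fun hlt => ?_⟩
    exact (hmax ((hgt he f hlt).1 hf)).not_gt hlt

/-- Add the element `e` to `S`, or remove it if it is there. -/
def toggle (e : α) (S : Finset α) : Finset α :=
  if e ∈ S then S.erase e else insert e S

theorem toggle_of_mem {e : α} {S : Finset α} (h : e ∈ S) : toggle e S = S.erase e := if_pos h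

theorem toggle_of_notMem {e : α} {S : Finset α} (h : e ∉ S) : toggle e S = insert e S := if_neg h

theorem toggle_toggle (e : α) (S : Finset α) : toggle e (toggle e S) = S := by
  by_cases h : e ∈ S
  · rw [toggle_of_mem h, toggle_of_notMem (by simp), Finset.insert_erase h]
  · rw [toggle_of_notMem h, toggle_of_mem (by simp), Finset.erase_insert h]

theorem toggle_ne (e : α) (S : Finset α) : toggle e S ≠ S := by
  by_cases h : e ∈ S
  · rw [toggle_of_mem h]
    exact fun h' => (Finset.erase_eq_self.1 h') h
  · rw [toggle_of_notMem h]
    exact fun h' => h (Finset.insert_eq_self.1 h')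

theorem isGreatest_closing_toggle {S : Finset α} {e : α} :
    IsGreatest (closing M (toggle e S : Finset α)) e ↔ IsGreatest (closing M (S : Set α)) e := by
  by_cases h : e ∈ S
  · rw [toggle_of_mem h, ← isGreatest_closing_insert, ← Finset.coe_insert, Finset.insert_erase h]
  · rw [toggle_of_notMem h, Finset.coe_insert, isGreatest_closing_insert]

/-- The summand of `S` in `T_M(1 + q, 0)`. -/
noncomputable def tutteTerm (M : Matroid α) (S : Finset α) : ℤ[X] :=
  X ^ ((M.eRk M.E).toNat - (M.eRk (S : Set α)).toNat) *
    (-1) ^ (S.card - (M.eRk (S : Set α)).toNat)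

/-- The rank is unchanged while the cardinality grows by one, so only the sign flips. The bound r(S)
≤ |S| keeps the natural subtraction exact. -/
theorem tutteTerm_insert_add {S : Finset α} {e : α} (he : e ∈ closing M (S : Set α))
    (heS : e ∉ S) : tutteTerm M (insert e S) + tutteTerm M S = 0 := by
  have hr : M.eRk ((insert e S : Finset α) : Set α) = M.eRk (S : Set α) := by
    rw [Finset.coe_insert, ← M.eRk_closure_eq, Matroid.closure_insert_eq_of_mem_closure
      (M.closure_subset_closure Set.inter_subset_left he), M.eRk_closure_eq]
  rw [tutteTerm, tutteTerm, hr, Finset.card_insert_of_notMem heS,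
    Nat.sub_add_comm (toNat_eRk_le_card M S), pow_succ]
  ring

theorem tutteTerm_toggle_add {S : Finset α} {e : α} (he : IsGreatest (closing M (S : Set α)) e) :
    tutteTerm M S + tutteTerm M (toggle e S) = 0 := by
  by_cases h : e ∈ S
  · have := tutteTerm_insert_add (isGreatest_closing_toggle.2 he).1 (S := toggle e S)
      (by simp [toggle_of_mem h])
    rwa [toggle_of_mem h, Finset.insert_erase h, ← toggle_of_mem h] at this
  · rw [toggle_of_notMem h, add_comm]
    exact tutteTerm_insert_add he.1 h

theorem closing_subset_ground (M : Matroid α) (S : Set α) : closing M S ⊆ M.E :=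
  fun _ he => M.closure_subset_ground _ he

variable [M.Finite]

open Classical in
/-- The nbc sets as a finite set. -/
noncomputable def nbcFinset (M : Matroid α) [M.Finite] : Finset (Finset α) :=
  M.ground_finite.toFinset.powerset.filter (· ∈ (nbc M).faces)

theorem mem_nbcFinset {S : Finset α} : S ∈ nbcFinset M ↔ S ∈ (nbc M).faces := by
  simp only [nbcFinset, Finset.mem_filter, Finset.mem_powerset, subset_ground_iff,
    and_iff_right_iff_imp]
  exact fun h => h.1

/-- Whitney's broken circuit theorem. -/
theorem aeval_tutte :
    MvPolynomial.aeval ![1 + X, (0 : ℤ[X])] (tutte M) =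
      ∑ T ∈ nbcFinset M, X ^ ((M.eRk M.E).toNat - T.card) := by
  classical
  have hT : MvPolynomial.aeval ![1 + X, (0 : ℤ[X])] (tutte M) =
      ∑ S ∈ M.ground_finite.toFinset.powerset, tutteTerm M S := by
    simp [tutte, tutteTerm]
  have hzero : ∑ S ∈ M.ground_finite.toFinset.powerset with ¬ S ∈ (nbc M).faces,
      tutteTerm M S = 0 := by
    have hex : ∀ S ∈ M.ground_finite.toFinset.powerset.filter (¬ · ∈ (nbc M).faces),
        ∃ e, IsGreatest (closing M (S : Set α)) e := by
      intro S hS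
      rw [Finset.mem_filter, Finset.mem_powerset, subset_ground_iff] at hS
      rw [mem_nbc_iff_closing_eq_empty hS.1] at hS
      obtain ⟨e, he, hmax⟩ := Set.exists_max_image _ id
        (M.ground_finite.subset (closing_subset_ground M S)) (Set.nonempty_iff_ne_empty.2 hS.2)
      exact ⟨e, he, hmax⟩
    have hmem : ∀ S ∈ M.ground_finite.toFinset.powerset.filter (¬ · ∈ (nbc M).faces),
        ∀ e, IsGreatest (closing M (S : Set α)) e →
          toggle e S ∈ M.ground_finite.toFinset.powerset.filter (¬ · ∈ (nbc M).faces) := by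
      intro S hS e he
      rw [Finset.mem_filter, Finset.mem_powerset, subset_ground_iff] at hS ⊢
      have hsub : ((toggle e S : Finset α) : Set α) ⊆ M.E := by
        by_cases h : e ∈ S
        · rw [toggle_of_mem h]
          exact (Finset.coe_subset.2 (Finset.erase_subset e S)).trans hS.1
        · rw [toggle_of_notMem h, Finset.coe_insert]
          exact Set.insert_subset (closing_subset_ground M S he.1) hS.1
      refine ⟨hsub, ?_⟩
      rw [mem_nbc_iff_closing_eq_empty hsub]
      exact (isGreatest_closing_toggle.2 he).nonempty.ne_empty
    choose m hm using hex
    refine Finset.sum_involution (fun S hS => toggle (m S hS) S)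
      (fun S hS => tutteTerm_toggle_add (hm S hS)) (fun S _ _ => toggle_ne _ S)
      (fun S hS => hmem S hS _ (hm S hS)) fun S hS => ?_
    -- The toggled set has the same greatest closing element, so the same element is toggled back.
    have : m (toggle (m S hS) S) (hmem S hS _ (hm S hS)) = m S hS :=
      (hm _ (hmem S hS _ (hm S hS))).unique (isGreatest_closing_toggle.2 (hm S hS))
    simp only [this, toggle_toggle]
  rw [hT, ← Finset.sum_filter_add_sum_filter_not _ (· ∈ (nbc M).faces), hzero, add_zero]
  refine Finset.sum_congr (by rfl) fun T hT => ?_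
  have hr := (indep_of_mem_nbc (Finset.mem_filter.1 hT).2).eRk_eq_encard
  rw [Set.encard_coe_eq_coe_finsetCard] at hr
  simp [tutteTerm, hr]

end Whitney

/-! ### Face enumeration and h-vectors. -/

section Enumeration

theorem Complex.hPoly_eq_sum {V : Type*} (Δ : Complex V) (s : Finset (Finset V))
    (hs : ∀ A, A ∈ s ↔ A ∈ Δ.faces) (hcard : ∀ A ∈ s, A.card ≤ Δ.size) :
    Δ.hPoly = ∑ A ∈ s, (X - 1) ^ (Δ.size - A.card) := by
  classical
  have hf (i : ℕ) : Δ.fNum i = (s.filter (·.card = i)).card := by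
    rw [Complex.fNum, ← Set.ncard_coe_finset]
    congr 1
    ext A
    simp [hs]
  rw [← Finset.sum_fiberwise_of_maps_to (t := Finset.range (Δ.size + 1)) (g := Finset.card)
    fun A hA => Finset.mem_range.2 (Nat.lt_succ_of_le (hcard A hA))]
  refine Finset.sum_congr rfl fun i _ => ?_
  rw [Finset.sum_congr rfl fun A hA => by rw [(Finset.mem_filter.1 hA).2], Finset.sum_const, hf]
  simp

theorem Complex.size_eq {V : Type*} {Δ : Complex V} {A : Finset V} (hA : A ∈ Δ.faces)
    (hmax : ∀ B ∈ Δ.faces, B.card ≤ A.card) : Δ.size = A.card :=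
  IsGreatest.csSup_eq ⟨⟨A, hA, rfl⟩, by rintro _ ⟨B, hB, rfl⟩; exact hmax B hB⟩

/-- The default `sSup ∅ = 0` in ℕ matches the convention d = 0 for the void complex. -/
theorem Complex.size_eq_zero {V : Type*} {Δ : Complex V} (h : Δ.faces = ∅) : Δ.size = 0 := by
  simp [Complex.size, h]

variable {α : Type*} [LinearOrder α] {M : Matroid α} [M.Finite]

theorem card_relatedBasis (I : NBCSet M) : (relatedBasis M I.1).card = (M.eRk M.E).toNat := by
  rw [← card_facetG I, facetG, yz, Finset.card_disjSum,
    Finset.card_sdiff_add_card_eq_card (isRelatedBasis_of_nbcSet I).subset]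

theorem size_augNBC (I : NBCSet M) : (augNBC M).size = (M.eRk M.E).toNat := by
  rw [← card_facetG I]
  refine Complex.size_eq ⟨I, subset_rfl⟩ ?_
  rintro A ⟨J, hJ⟩
  rw [card_facetG I, ← card_facetG J]
  exact Finset.card_le_card hJ

theorem card_le_of_mem_nbc {I : Finset α} (hI : I ∈ (nbc M).faces) :
    I.card ≤ (M.eRk M.E).toNat := by
  rw [← card_relatedBasis ⟨I, hI⟩]
  exact Finset.card_le_card (isRelatedBasis_of_nbcSet ⟨I, hI⟩).subset

theorem size_nbc (I : NBCSet M) : (nbc M).size = (M.eRk M.E).toNat := by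
  have h0 : ∅ ∈ (nbc M).faces := (nbc M).down_closed (Finset.empty_subset I.1) I.2
  have h := card_relatedBasis (M := M) ⟨∅, h0⟩
  rw [← h]
  refine Complex.size_eq (relatedBasis_empty_mem_nbc h0 (isRelatedBasis_of_nbcSet ⟨∅, h0⟩)) ?_
  intro B hB
  rw [h]
  exact card_le_of_mem_nbc hB

/-- The faces of the augmented nbc complex as a finite set. -/
noncomputable def augNBCFinset (M : Matroid α) [M.Finite] : Finset (Finset (α ⊕ α)) :=
  (nbcFinset M).biUnion fun T => (relatedBasis M T \ T).powerset.image (yz · T)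

theorem mem_augNBCFinset {A : Finset (α ⊕ α)} :
    A ∈ augNBCFinset M ↔ A ∈ (augNBC M).faces := by
  simp only [augNBCFinset, Finset.mem_biUnion, Finset.mem_image, Finset.mem_powerset,
    mem_nbcFinset]
  constructor
  · rintro ⟨T, hT, S, hS, rfl⟩
    exact ⟨⟨T, hT⟩, Finset.disjSum_mono hS subset_rfl⟩
  · rintro ⟨J, hJ⟩
    -- The z-part T of any face is nbc, and the face already lies in G(T).
    have hsub : A.toRight ⊆ J.1 := (Finset.subset_disjSum.1 hJ).2
    have hT := (nbc M).down_closed hsub J.2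
    exact ⟨A.toRight, hT, A.toLeft,
      (Finset.subset_disjSum.1 (subset_facetG_of_toRight (I := ⟨_, hT⟩) hJ subset_rfl hsub)).1,
      Finset.toLeft_disjSum_toRight⟩

theorem hPoly_augNBC :
    (augNBC M).hPoly = ∑ T ∈ nbcFinset M, X ^ ((M.eRk M.E).toNat - T.card) := by
  rw [Complex.hPoly_eq_sum _ (augNBCFinset M) fun A => mem_augNBCFinset]
  · rw [augNBCFinset, Finset.sum_biUnion]
    · refine Finset.sum_congr rfl fun T hT => ?_
      rw [mem_nbcFinset] at hT
      have hB := (isRelatedBasis_of_nbcSet ⟨T, hT⟩).subset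
      have hcard := card_relatedBasis ⟨T, hT⟩
      dsimp only at hB hcard
      rw [Finset.sum_image (g := (yz · T)) fun S _ S' _ h => (Finset.disjSum_inj.1 h).1, ← hcard,
        ← Finset.card_sdiff_of_subset hB, size_augNBC ⟨T, hT⟩, ← hcard]
      -- Binomial theorem for (1 + (q - 1))^|B_T \ T|.
      have := Finset.sum_pow_mul_eq_add_pow (1 : ℤ[X]) (X - 1) (relatedBasis M T \ T)
      rw [add_sub_cancel] at this
      rw [← this]
      refine Finset.sum_congr rfl fun S _ => ?_
      rw [one_pow, one_mul, yz, Finset.card_disjSum, Finset.card_sdiff_of_subset hB,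
        Nat.sub_sub, add_comm]
    -- T is recovered as the z-part of the face.
    · intro T _ T' _ hne
      refine Finset.disjoint_left.2 fun A hA hA' => hne ?_
      obtain ⟨S, -, rfl⟩ := Finset.mem_image.1 hA
      obtain ⟨S', -, h⟩ := Finset.mem_image.1 hA'
      exact (Finset.disjSum_inj.1 h).2.symm
  · intro A hA
    obtain ⟨J, hJ⟩ := mem_augNBCFinset.1 hA
    rw [size_augNBC J, ← card_facetG J]
    exact Finset.card_le_card hJ

theorem hVector_augNBC : (augNBC M).hVector = (nbc M).fVector := by
  have hsize : (augNBC M).size = (nbc M).size := by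
    rcases isEmpty_or_nonempty (NBCSet M) with h | ⟨⟨I⟩⟩
    · have h0 : (nbc M).faces = ∅ := Set.eq_empty_iff_forall_notMem.2 fun S hS => h.false ⟨S, hS⟩
      have h1 : (augNBC M).faces = ∅ :=
        Set.eq_empty_iff_forall_notMem.2 fun A ⟨I, _⟩ => h.false I
      rw [Complex.size_eq_zero h0, Complex.size_eq_zero h1]
    · rw [size_augNBC I, size_nbc I]
  rw [Complex.hVector, Complex.fVector, hsize]
  refine List.map_congr_left fun i hi => ?_
  have hi' : i ≤ (nbc M).size := Nat.lt_succ_iff.1 (List.mem_range.1 hi)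
  rw [hPoly_augNBC, Polynomial.finsetSum_coeff]
  have hf : (nbc M).fNum i = ((nbcFinset M).filter (·.card = i)).card := by
    rw [Complex.fNum, ← Set.ncard_coe_finset]
    congr 1
    ext A
    simp [mem_nbcFinset]
  rw [hf, Finset.card_filter, Nat.cast_sum]
  refine Finset.sum_congr rfl fun T hT => ?_
  rw [mem_nbcFinset] at hT
  have hT' := card_le_of_mem_nbc hT
  rw [size_nbc ⟨T, hT⟩] at hi' ⊢
  rw [Polynomial.coeff_X_pow, Nat.cast_ite, Nat.cast_one, Nat.cast_zero]
  -- Truncated subtraction is harmless here: i and |T| are both at most r.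
  exact if_congr (by omega) rfl rfl

end Enumeration

end AugNBC

theorem mainTheorem5 {α : Type*} [LinearOrder α] (M : Matroid α) [M.Finite] :
    (∀ lt : AugNBC.NBCSet M → AugNBC.NBCSet M → Prop, AugNBC.IsLinearExtension M lt →
      AugNBC.IsShelling (AugNBC.augNBC M) lt (AugNBC.facetG M) ∧
      ∀ I : AugNBC.NBCSet M,
        AugNBC.IsRestrictionSet lt (AugNBC.facetG M) I (AugNBC.yz ∅ I.1)) ∧
    (AugNBC.augNBC M).hPoly =
      MvPolynomial.aeval ![1 + Polynomial.X, (0 : Polynomial ℤ)] (AugNBC.tutte M) ∧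
    (AugNBC.augNBC M).hVector = (AugNBC.nbc M).fVector :=
  ⟨fun _ h => ⟨h.isShelling, h.isRestrictionSet⟩,
    AugNBC.hPoly_augNBC.trans AugNBC.aeval_tutte.symm, AugNBC.hVector_augNBC⟩
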